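/- Fix a finite label alphabet $\Lambda$. A graph $G$ consists of finite sets $V_G$, $E_G$ of nodes and edges, source and target functions $E_G\to V_G$, and labelling functions $V_G\to\Lambda$, $E_G\to\Lambda$; morphisms are pairs of functions preserving sources, targets and labels, and are injective ($\hookrightarrow$) if both components are. Conditions over a graph $P$ are defined inductively: $\mathtt{true}$; $\exists(a,c)$ for an injective $a\colon P\hookrightarrow C$ and a condition $c$ over $C$; $\neg c$ and $c\wedge c'$ for conditions $c,c'$ over $P$. An injective $g\colon P\hookrightarrow G$ satisfies $\exists(a,c)$ if there is an injective $q\colon C\hookrightarrow G$ with $q\circ a=g$ and $q\models c$; $\mathtt{true},\neg,\wedge$ are interpreted as usual. A plain rule is $p=\langle L\hookleftarrow K\hookrightarrow R\rangle$; a rule $\langle p,ac\rangle$ is a plain rule with a condition $ac$ over $L$, and $p$ abbreviates $\langle p,\mathtt{true}\rangle$. A transformation $G\Rightarrow_{\langle p,ac\rangle}H$ at an injective match $g\colon L\hookrightarrow G$ with $g\models ac$ consists of a graph $D$ and two pushouts $L\leftarrow K\to D$ with object $G$ (along $g$) and $R\leftarrow K\to D$ with object $H$. A rule is applicable to $G$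 if there is a transformation $G\Rightarrow H$ via it for some $H$. A graph transformation system (GTS) $\mathcal R$ is a finite set of rules; $G\Rightarrow_{\mathcal R}H$ means $G\Rightarrow_r H$ for some $r\in\mathcal R$. Let $\mathtt{Skip}=\langle\varnothing\hookleftarrow\varnothing\hookrightarrow\varnothing\rangle$. **Proposition (applicability).** To every GTS $\mathcal R$ and every plain rule $p=\langle L\hookleftarrow K\hookrightarrow R\rangle$ one can assign a condition $\mathrm{app}(\mathcal R,p)$ over $L$ such that: 1. for every transformation $G\Rightarrow_p H'$ at a match $g\colon L\hookrightarrow G$, $\;g\models\mathrm{app}(\mathcal R,p)$ if and only if there is a graph $H$ with $G\Rightarrow_{\mathcal R}H$; 2. consequently, if $\langle p,\neg\mathrm{app}(\mathcal R,p)\rangle$ is applicable to a graph $G$, then no rule of $\mathcal R$ is applicable to $G$; 3. $\langle\mathtt{Skip},\neg\mathrm{app}(\mathcal R,\mathtt{Skip})\rangle$ is applicable to a graph $G$ if and only if no rule of $\mathcal R$ is applicable to $G$; 4. for the completion $\overline{\mathcal R}=\mathcal R\cup\{\langle\mathtt{Skip},\neg\mathrm{app}(\mathcal R,\mathtt{Skip})\rangle\}$,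 every graph $G$ admits a transformation $G\Rightarrow_{\overline{\mathcal R}}H$ for some graph $H$ (so every transformation sequence can be continued). -/

import Mathlib

open CategoryTheory

universe u v

/-- Finite directed graphs with node and edge labels in `Λ`. -/
structure LGraph (Λ : Type v) where
  V : Type u
  E : Type u
  finV : Finite V
  finE : Finite E
  src : E → V
  tgt : E → V
  labV : V → Λ
  labE : E → Λ

namespace LGraph

variable {Λ : Type v}

/-- Graph morphisms: pairs of functions preserving sources, targets and labels. -/
@[ext]
structure Hom (G H : LGraph.{u, v} Λ) where
  onV : G.V → H.V
  onE : G.E → H.E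
  src_comm : ∀ e, onV (G.src e) = H.src (onE e)
  tgt_comm : ∀ e, onV (G.tgt e) = H.tgt (onE e)
  labV_comm : ∀ x, G.labV x = H.labV (onV x)
  labE_comm : ∀ e, G.labE e = H.labE (onE e)

/-- The category of finite labelled graphs, with componentwise composition. -/
instance : Category.{u} (LGraph.{u, v} Λ) where
  Hom := Hom
  id G := ⟨id, id, fun _ => rfl, fun _ => rfl, fun _ => rfl, fun _ => rfl⟩
  comp f g :=
    ⟨g.onV ∘ f.onV, g.onE ∘ f.onE,
      fun e => by simp [f.src_comm, g.src_comm],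
      fun e => by simp [f.tgt_comm, g.tgt_comm],
      fun x => by simp [f.labV_comm, g.labV_comm],
      fun e => by simp [f.labE_comm, g.labE_comm]⟩

/-- A morphism is injective if both of its components are. -/
def Inj {G H : LGraph.{u, v} Λ} (f : G ⟶ H) : Prop :=
  Function.Injective (Hom.onV f) ∧ Function.Injective (Hom.onE f)

/-- The empty graph. -/
def empty (Λ : Type v) : LGraph.{u, v} Λ where
  V := PEmpty
  E := PEmpty
  finV := inferInstance
  finE := inferInstance
  src := PEmpty.elim
  tgt := PEmpty.elim
  labV := PEmpty.elim
  labE := PEmpty.elim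

theorem inj_id (G : LGraph.{u, v} Λ) : Inj (𝟙 G) :=
  ⟨Function.injective_id, Function.injective_id⟩

end LGraph

/-- (Nested) graph conditions over a graph. -/
inductive GCond {Λ : Type v} : LGraph.{u, v} Λ → Type (max (u + 1) v)
  | tt {P : LGraph.{u, v} Λ} : GCond P
  | ex {P C : LGraph.{u, v} Λ} (a : P ⟶ C) (ha : LGraph.Inj a) (c : GCond C) : GCond P
  | neg {P : LGraph.{u, v} Λ} (c : GCond P) : GCond P
  | and {P : LGraph.{u, v} Λ} (c c' : GCond P) : GCond P

/-- `c.Sat g` is the satisfaction `g ⊨ c`; it is used for injective `g` only. -/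
def GCond.Sat {Λ : Type v} {G : LGraph.{u, v} Λ} :
    {P : LGraph.{u, v} Λ} → GCond P → (P ⟶ G) → Prop
  | _, .tt, _ => True
  | _, .ex (C := C) a _ c, g => ∃ q : C ⟶ G, LGraph.Inj q ∧ a ≫ q = g ∧ c.Sat q
  | _, .neg c, g => ¬ c.Sat g
  | _, .and c c', g => c.Sat g ∧ c'.Sat g

/-- Plain rules `L ↩ K ↪ R`. -/
structure PlainRule (Λ : Type v) where
  L : LGraph.{u, v} Λ
  K : LGraph.{u, v} Λ
  R : LGraph.{u, v} Λ
  l : K ⟶ L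
  r : K ⟶ R
  l_inj : LGraph.Inj l
  r_inj : LGraph.Inj r

/-- Rules: a plain rule with a (left) application condition. -/
structure GRule (Λ : Type v) where
  plain : PlainRule.{u, v} Λ
  ac : GCond plain.L

namespace GRule

variable {Λ : Type v}

/-- `ρ.StepAt g H`: there is a direct transformation `G ⇒ H` applying `ρ` at the match `g`,
that is, a double pushout diagram whose injective match satisfies the application condition. -/
def StepAt (ρ : GRule.{u, v} Λ) {G : LGraph.{u, v} Λ} (g : ρ.plain.L ⟶ G)
    (H : LGraph.{u, v} Λ) : Prop :=
  LGraph.Inj g ∧ ρ.ac.Sat g ∧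
    ∃ (D : LGraph.{u, v} Λ) (d : ρ.plain.K ⟶ D) (h : ρ.plain.R ⟶ H) (l' : D ⟶ G) (r' : D ⟶ H),
      IsPushout ρ.plain.l d g l' ∧ IsPushout ρ.plain.r d h r'

/-- `G ⇒ H` via the rule. -/
def Step (ρ : GRule.{u, v} Λ) (G H : LGraph.{u, v} Λ) : Prop :=
  ∃ g : ρ.plain.L ⟶ G, ρ.StepAt g H

/-- The rule is applicable to `G`. -/
def Applicable (ρ : GRule.{u, v} Λ) (G : LGraph.{u, v} Λ) : Prop :=
  ∃ H, ρ.Step G H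

end GRule

/-- The plain rule `p` regarded as the rule `⟨p, true⟩`. -/
def PlainRule.toRule {Λ : Type v} (p : PlainRule.{u, v} Λ) : GRule.{u, v} Λ :=
  ⟨p, GCond.tt⟩

/-- The rule `Skip = ⟨∅ ⇒ ∅⟩`. -/
def PlainRule.skip (Λ : Type v) : PlainRule.{u, v} Λ where
  L := LGraph.empty Λ
  K := LGraph.empty Λ
  R := LGraph.empty Λ
  l := 𝟙 _
  r := 𝟙 _
  l_inj := LGraph.inj_id _
  r_inj := LGraph.inj_id _

/-- Graph transformation systems: finite sets of rules. -/
structure GTS (Λ : Type v) where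
  rules : Set (GRule.{u, v} Λ)
  fin : rules.Finite

namespace GTS

variable {Λ : Type v}

/-- `G ⇒ H` via some rule of the system. -/
def Step (S : GTS.{u, v} Λ) (G H : LGraph.{u, v} Λ) : Prop :=
  ∃ ρ ∈ S.rules, ρ.Step G H

/-- The system together with the rule `⟨Skip, ¬ c⟩`; the completion of the system is the case
where `c` is the condition `app(S, Skip)`. -/
def addSkip (S : GTS.{u, v} Λ) (c : GCond (PlainRule.skip.{u, v} Λ).L) : GTS.{u, v} Λ where
  rules := S.rules ∪ {⟨PlainRule.skip Λ, c.neg⟩}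
  fin := S.fin.union (Set.finite_singleton _)

end GTS

/-! Whether some rule of the system applies to `G` does not depend on the match of `p`, so it
suffices to express this property of `G` as a condition over the empty graph and to shift it to `L`.
For an injective match, a transformation exists exactly when the application condition holds and no
dangling edge occurs (`GRule.exists_stepAt_iff`). Dangling is itself expressible: up to isomorphism
there are only finitely many ways to extend `L` by one edge (`GCond.exists_dangling`). Hence a
single rule yields `∃(∅ → L, ac ∧ ¬ dangling)`, and a finite system yields a finite disjunction.
Shifting (`GCond.exists_shift`) rests on the same finiteness: a pair of jointly surjective morphisms
is a quotient of a disjoint union, and a finite graph has finitely many quotients. -/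

namespace LGraph

variable {Λ : Type v}

section Basic

variable {G H K : LGraph.{u, v} Λ}

@[simp]
theorem comp_onV (f : G ⟶ H) (g : H ⟶ K) (x : G.V) :
    Hom.onV (f ≫ g) x = Hom.onV g (Hom.onV f x) := rfl

@[simp]
theorem comp_onE (f : G ⟶ H) (g : H ⟶ K) (e : G.E) :
    Hom.onE (f ≫ g) e = Hom.onE g (Hom.onE f e) := rfl

theorem hom_ext {f g : G ⟶ H} (hV : ∀ x, Hom.onV f x = Hom.onV g x)
    (hE : ∀ e, Hom.onE f e = Hom.onE g e) : f = g :=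
  Hom.ext (funext hV) (funext hE)

theorem onV_congr {f g : G ⟶ H} (h : f = g) (x : G.V) : Hom.onV f x = Hom.onV g x := by
  rw [h]

theorem onE_congr {f g : G ⟶ H} (h : f = g) (e : G.E) : Hom.onE f e = Hom.onE g e := by
  rw [h]

theorem Inj.comp {f : G ⟶ H} {g : H ⟶ K} (hf : Inj f) (hg : Inj g) : Inj (f ≫ g) :=
  ⟨hg.1.comp hf.1, hg.2.comp hf.2⟩

theorem Inj.of_comp {f : G ⟶ H} {g : H ⟶ K} (h : Inj (f ≫ g)) : Inj f :=
  ⟨Function.Injective.of_comp (f := Hom.onV g) h.1,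
    Function.Injective.of_comp (f := Hom.onE g) h.2⟩

/-- The unique morphism out of the empty graph. -/
def fromEmpty (G : LGraph.{u, v} Λ) : empty Λ ⟶ G :=
  Hom.mk (fun x => x.elim) (fun e => e.elim) (fun e => e.elim) (fun e => e.elim)
    (fun x => x.elim) (fun e => e.elim)

theorem fromEmpty_inj (G : LGraph.{u, v} Λ) : Inj (fromEmpty G) :=
  ⟨fun x => x.elim, fun e => e.elim⟩

theorem hom_empty_ext (f g : empty Λ ⟶ G) : f = g :=
  hom_ext (fun x => x.elim) (fun e => e.elim)

end Basic

/-! ### Disjoint unions -/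

section Coproduct

/-- The disjoint union of two graphs. -/
def sum (A B : LGraph.{u, v} Λ) : LGraph.{u, v} Λ where
  V := A.V ⊕ B.V
  E := A.E ⊕ B.E
  finV := by
    have := A.finV
    have := B.finV
    infer_instance
  finE := by
    have := A.finE
    have := B.finE
    infer_instance
  src := Sum.map A.src B.src
  tgt := Sum.map A.tgt B.tgt
  labV := Sum.elim A.labV B.labV
  labE := Sum.elim A.labE B.labE

variable {A B G : LGraph.{u, v} Λ}

/-- The left inclusion into the disjoint union. -/
def sumInl (A B : LGraph.{u, v} Λ) : A ⟶ sum A B :=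
  Hom.mk (H := sum A B) Sum.inl Sum.inl (fun _ => rfl) (fun _ => rfl) (fun _ => rfl) (fun _ => rfl)

/-- The right inclusion into the disjoint union. -/
def sumInr (A B : LGraph.{u, v} Λ) : B ⟶ sum A B :=
  Hom.mk (H := sum A B) Sum.inr Sum.inr (fun _ => rfl) (fun _ => rfl) (fun _ => rfl) (fun _ => rfl)

/-- The morphism out of the disjoint union given by its two restrictions. -/
def sumDesc (f : A ⟶ G) (g : B ⟶ G) : sum A B ⟶ G :=
  Hom.mk (G := sum A B) (Sum.elim (Hom.onV f) (Hom.onV g)) (Sum.elim (Hom.onE f) (Hom.onE g))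
    (by rintro (e | e); exacts [Hom.src_comm f e, Hom.src_comm g e])
    (by rintro (e | e); exacts [Hom.tgt_comm f e, Hom.tgt_comm g e])
    (by rintro (e | e); exacts [Hom.labV_comm f e, Hom.labV_comm g e])
    (by rintro (e | e); exacts [Hom.labE_comm f e, Hom.labE_comm g e])

end Coproduct

/-! ### Quotients and image factorization -/

section Quotient

/-- Pairs of equivalence relations compatible with the graph structure. -/
structure Congr (X : LGraph.{u, v} Λ) where
  rV : Setoid X.V
  rE : Setoid X.E
  src_rel : ∀ e e', rE e e' → rV (X.src e) (X.src e')
  tgt_rel : ∀ e e', rE e e' → rV (X.tgt e) (X.tgt e')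
  labV_eq : ∀ x y, rV x y → X.labV x = X.labV y
  labE_eq : ∀ e e', rE e e' → X.labE e = X.labE e'

variable {X G : LGraph.{u, v} Λ}

theorem finite_setoid (α : Type u) [Finite α] : Finite (Setoid α) := by
  classical
  refine Finite.of_injective (fun r : Setoid α => fun a b => r a b) ?_
  intro r s h
  ext a b
  exact iff_of_eq (congrFun (congrFun h a) b)

/-- Overlaps of two graphs are indexed by congruences on their disjoint union, so this finiteness
keeps the disjunctions over overlaps finite. -/
instance : Finite (Congr X) := by
  have := X.finV
  have := X.finE
  have := finite_setoid X.V
  have := finite_setoid X.E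
  refine Finite.of_injective (fun k : Congr X => (k.rV, k.rE)) ?_
  rintro ⟨r, s, _, _, _, _⟩ ⟨r', s', _, _, _, _⟩ h
  simp only [Prod.mk.injEq] at h
  obtain ⟨rfl, rfl⟩ := h
  rfl

/-- The quotient of a graph by a congruence. -/
def quot (k : Congr X) : LGraph.{u, v} Λ where
  V := Quotient k.rV
  E := Quotient k.rE
  finV := by
    have := X.finV
    infer_instance
  finE := by
    have := X.finE
    infer_instance
  src := Quotient.map X.src k.src_rel
  tgt := Quotient.map X.tgt k.tgt_rel
  labV := Quotient.lift X.labV k.labV_eq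
  labE := Quotient.lift X.labE k.labE_eq

/-- The projection to the quotient. -/
def proj (k : Congr X) : X ⟶ quot k :=
  Hom.mk (H := quot k) (Quotient.mk k.rV) (Quotient.mk k.rE)
    (fun _ => rfl) (fun _ => rfl) (fun _ => rfl) (fun _ => rfl)

/-- The kernel congruence of a morphism. -/
def ker (f : X ⟶ G) : Congr X where
  rV := Setoid.ker (Hom.onV f)
  rE := Setoid.ker (Hom.onE f)
  src_rel e e' h := by
    change Hom.onE f e = Hom.onE f e' at h
    change Hom.onV f _ = Hom.onV f _
    rw [Hom.src_comm f, Hom.src_comm f, h]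
  tgt_rel e e' h := by
    change Hom.onE f e = Hom.onE f e' at h
    change Hom.onV f _ = Hom.onV f _
    rw [Hom.tgt_comm f, Hom.tgt_comm f, h]
  labV_eq x y h := by
    change Hom.onV f x = Hom.onV f y at h
    rw [Hom.labV_comm f, Hom.labV_comm f, h]
  labE_eq e e' h := by
    change Hom.onE f e = Hom.onE f e' at h
    rw [Hom.labE_comm f, Hom.labE_comm f, h]

/-- The injective part of the image factorization of a morphism. -/
def kerLift (f : X ⟶ G) : quot (ker f) ⟶ G :=
  Hom.mk (G := quot (ker f))
    (Quotient.lift (Hom.onV f) fun _ _ h => h) (Quotient.lift (Hom.onE f) fun _ _ h => h)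
    (by rintro ⟨e⟩; exact Hom.src_comm f e) (by rintro ⟨e⟩; exact Hom.tgt_comm f e)
    (by rintro ⟨x⟩; exact Hom.labV_comm f x) (by rintro ⟨e⟩; exact Hom.labE_comm f e)

theorem kerLift_inj (f : X ⟶ G) : Inj (kerLift f) := by
  constructor
  · rintro ⟨x⟩ ⟨y⟩ h
    exact Quotient.sound h
  · rintro ⟨x⟩ ⟨y⟩ h
    exact Quotient.sound h

end Quotient

/-! ### Pushouts along injective morphisms as concrete gluings -/

section Pushout

variable {K A D G T : LGraph.{u, v} Λ}

/-- A commutative square of functions which is a pullback, jointly surjective, and has injective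
legs into its corner. -/
structure GluingSq {K A D G : Type u} (i : K → A) (d : K → D) (g : A → G) (j : D → G) : Prop where
  comm : ∀ k, g (i k) = j (d k)
  inj_left : Function.Injective g
  inj_right : Function.Injective j
  cover : ∀ y, (∃ x, g x = y) ∨ ∃ z, j z = y
  meet : ∀ x z, g x = j z → ∃ k, i k = x ∧ d k = z

theorem GluingSq.exists_desc {K A D G T : Type u} {i : K → A} {d : K → D} {g : A → G} {j : D → G}
    (h : GluingSq i d g j) (a : A → T) (b : D → T) (hab : ∀ k, a (i k) = b (d k)) :
    ∃ f : G → T, (∀ x, f (g x) = a x) ∧ ∀ z, f (j z) = b z := by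
  have key : ∀ y, ∃ t, (∀ x, g x = y → t = a x) ∧ ∀ z, j z = y → t = b z := by
    intro y
    rcases h.cover y with ⟨x, rfl⟩ | ⟨z, rfl⟩
    · refine ⟨a x, fun x' hx => by rw [h.inj_left hx], fun z hz => ?_⟩
      obtain ⟨k, rfl, rfl⟩ := h.meet x z hz.symm
      exact hab k
    · refine ⟨b z, fun x hx => ?_, fun z' hz => by rw [h.inj_right hz]⟩
      obtain ⟨k, rfl, rfl⟩ := h.meet x z hx
      exact (hab k).symm
  choose f hf using key
  exact ⟨f, fun x => (hf _).1 x rfl, fun z => (hf _).2 z rfl⟩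

/-- A square of graphs that is a gluing on nodes and on edges. -/
def IsGluing (i : K ⟶ A) (d : K ⟶ D) (g : A ⟶ G) (j : D ⟶ G) : Prop :=
  GluingSq (Hom.onV i) (Hom.onV d) (Hom.onV g) (Hom.onV j) ∧
    GluingSq (Hom.onE i) (Hom.onE d) (Hom.onE g) (Hom.onE j)

variable {i : K ⟶ A} {d : K ⟶ D} {g : A ⟶ G} {j : D ⟶ G}

theorem IsGluing.hom_ext (h : IsGluing i d g j) {f f' : G ⟶ T} (hg : g ≫ f = g ≫ f')
    (hj : j ≫ f = j ≫ f') : f = f' := by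
  refine LGraph.hom_ext (fun y => ?_) fun y => ?_
  · rcases h.1.cover y with ⟨x, rfl⟩ | ⟨x, rfl⟩
    exacts [onV_congr hg x, onV_congr hj x]
  · rcases h.2.cover y with ⟨x, rfl⟩ | ⟨x, rfl⟩
    exacts [onE_congr hg x, onE_congr hj x]

theorem IsGluing.exists_desc (h : IsGluing i d g j) (a : A ⟶ T) (b : D ⟶ T)
    (hab : i ≫ a = d ≫ b) : ∃ f : G ⟶ T, g ≫ f = a ∧ j ≫ f = b := by
  obtain ⟨fV, hVa, hVb⟩ := h.1.exists_desc (Hom.onV a) (Hom.onV b) (onV_congr hab)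
  obtain ⟨fE, hEa, hEb⟩ := h.2.exists_desc (Hom.onE a) (Hom.onE b) (onE_congr hab)
  refine ⟨Hom.mk fV fE ?_ ?_ ?_ ?_, LGraph.hom_ext hVa hEa, LGraph.hom_ext hVb hEb⟩
  · intro y
    rcases h.2.cover y with ⟨x, rfl⟩ | ⟨x, rfl⟩
    · rw [← Hom.src_comm g, hVa, hEa, Hom.src_comm a]
    · rw [← Hom.src_comm j, hVb, hEb, Hom.src_comm b]
  · intro y
    rcases h.2.cover y with ⟨x, rfl⟩ | ⟨x, rfl⟩
    · rw [← Hom.tgt_comm g, hVa, hEa, Hom.tgt_comm a]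
    · rw [← Hom.tgt_comm j, hVb, hEb, Hom.tgt_comm b]
  · intro y
    rcases h.1.cover y with ⟨x, rfl⟩ | ⟨x, rfl⟩
    · rw [hVa, ← Hom.labV_comm g, Hom.labV_comm a]
    · rw [hVb, ← Hom.labV_comm j, Hom.labV_comm b]
  · intro y
    rcases h.2.cover y with ⟨x, rfl⟩ | ⟨x, rfl⟩
    · rw [hEa, ← Hom.labE_comm g, Hom.labE_comm a]
    · rw [hEb, ← Hom.labE_comm j, Hom.labE_comm b]

theorem IsGluing.isPushout (h : IsGluing i d g j) : IsPushout i d g j := by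
  have w : i ≫ g = d ≫ j := LGraph.hom_ext h.1.comm h.2.comm
  refine ⟨⟨w⟩, ⟨Limits.PushoutCocone.IsColimit.mk w
    (fun s => (h.exists_desc s.inl s.inr s.condition).choose)
    (fun s => (h.exists_desc s.inl s.inr s.condition).choose_spec.1)
    (fun s => (h.exists_desc s.inl s.inr s.condition).choose_spec.2) ?_⟩⟩
  intro s m hl hr
  have hs := (h.exists_desc s.inl s.inr s.condition).choose_spec
  exact h.hom_ext (hl.trans hs.1.symm) (hr.trans hs.2.symm)

open Classical in
/-- The inclusion of `A` into the amalgam of `A` and `D` along `K`. -/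
noncomputable def amalgIn {K A D : Type u} (i : K → A) (d : K → D) (x : A) :
    D ⊕ {x : A // x ∉ Set.range i} :=
  if h : x ∈ Set.range i then Sum.inl (d h.choose) else Sum.inr ⟨x, h⟩

theorem amalgIn_apply {K A D : Type u} {i : K → A} (d : K → D) (hi : Function.Injective i)
    (k : K) : amalgIn i d (i k) = Sum.inl (d k) := by
  have h : i k ∈ Set.range i := ⟨k, rfl⟩
  rw [amalgIn, dif_pos h, hi h.choose_spec]

theorem amalgIn_of_notMem {K A D : Type u} {i : K → A} (d : K → D) {x : A}
    (h : x ∉ Set.range i) : amalgIn i d x = Sum.inr ⟨x, h⟩ := dif_neg h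

theorem gluingSq_amalg {K A D : Type u} {i : K → A} {d : K → D} (hi : Function.Injective i)
    (hd : Function.Injective d) : GluingSq i d (amalgIn i d) Sum.inl where
  comm := amalgIn_apply d hi
  inj_left := by
    intro x y hxy
    by_cases hx : x ∈ Set.range i <;> by_cases hy : y ∈ Set.range i
    · obtain ⟨k, rfl⟩ := hx
      obtain ⟨k', rfl⟩ := hy
      rw [amalgIn_apply d hi, amalgIn_apply d hi] at hxy
      rw [hd (Sum.inl_injective hxy)]
    · obtain ⟨k, rfl⟩ := hx
      rw [amalgIn_apply d hi, amalgIn_of_notMem d hy] at hxy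
      cases hxy
    · obtain ⟨k, rfl⟩ := hy
      rw [amalgIn_apply d hi, amalgIn_of_notMem d hx] at hxy
      cases hxy
    · rw [amalgIn_of_notMem d hx, amalgIn_of_notMem d hy] at hxy
      exact congrArg Subtype.val (Sum.inr_injective hxy)
  inj_right := Sum.inl_injective
  cover := by
    rintro (z | ⟨x, hx⟩)
    · exact Or.inr ⟨z, rfl⟩
    · exact Or.inl ⟨x, amalgIn_of_notMem d hx⟩
  meet := by
    intro x z hxz
    by_cases hx : x ∈ Set.range i
    · obtain ⟨k, rfl⟩ := hx
      rw [amalgIn_apply d hi] at hxz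
      exact ⟨k, rfl, Sum.inl_injective hxz⟩
    · rw [amalgIn_of_notMem d hx] at hxz
      cases hxz

theorem exists_isGluing (hi : Inj i) (hd : Inj d) :
    ∃ (Q : LGraph.{u, v} Λ) (a : A ⟶ Q) (b : D ⟶ Q), IsGluing i d a b := by
  let Q : LGraph.{u, v} Λ :=
    { V := D.V ⊕ {x : A.V // x ∉ Set.range (Hom.onV i)}
      E := D.E ⊕ {x : A.E // x ∉ Set.range (Hom.onE i)}
      finV := by
        have := A.finV
        have := D.finV
        infer_instance
      finE := by
        have := A.finE
        have := D.finE
        infer_instance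
      src := Sum.elim (fun e => Sum.inl (D.src e))
        (fun e => amalgIn (Hom.onV i) (Hom.onV d) (A.src e.1))
      tgt := Sum.elim (fun e => Sum.inl (D.tgt e))
        (fun e => amalgIn (Hom.onV i) (Hom.onV d) (A.tgt e.1))
      labV := Sum.elim D.labV (fun x => A.labV x.1)
      labE := Sum.elim D.labE (fun x => A.labE x.1) }
  let b : D ⟶ Q := Hom.mk (H := Q) Sum.inl Sum.inl (fun _ => rfl) (fun _ => rfl)
    (fun _ => rfl) (fun _ => rfl)
  let a : A ⟶ Q := Hom.mk (H := Q) (amalgIn (Hom.onV i) (Hom.onV d))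
    (amalgIn (Hom.onE i) (Hom.onE d))
    (by
      intro e
      by_cases he : e ∈ Set.range (Hom.onE i)
      · obtain ⟨k, rfl⟩ := he
        rw [← Hom.src_comm i, amalgIn_apply _ hi.1, amalgIn_apply _ hi.2, Hom.src_comm d]
        rfl
      · rw [amalgIn_of_notMem _ he]
        rfl)
    (by
      intro e
      by_cases he : e ∈ Set.range (Hom.onE i)
      · obtain ⟨k, rfl⟩ := he
        rw [← Hom.tgt_comm i, amalgIn_apply _ hi.1, amalgIn_apply _ hi.2, Hom.tgt_comm d]
        rfl
      · rw [amalgIn_of_notMem _ he]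
        rfl)
    (by
      intro e
      by_cases he : e ∈ Set.range (Hom.onV i)
      · obtain ⟨k, rfl⟩ := he
        rw [← Hom.labV_comm i, amalgIn_apply _ hi.1, Hom.labV_comm d]
        rfl
      · rw [amalgIn_of_notMem _ he]
        rfl)
    (by
      intro e
      by_cases he : e ∈ Set.range (Hom.onE i)
      · obtain ⟨k, rfl⟩ := he
        rw [← Hom.labE_comm i, amalgIn_apply _ hi.2, Hom.labE_comm d]
        rfl
      · rw [amalgIn_of_notMem _ he]
        rfl)
  exact ⟨Q, a, b, gluingSq_amalg hi.1 hd.1, gluingSq_amalg hi.2 hd.2⟩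

/-- The abstract pushout is compared with the concrete amalgam by the two universal morphisms; only
the facts needed for the dangling condition are transported back. -/
theorem cover_and_meet_of_isPushout (hi : Inj i) (hd : Inj d) (h : IsPushout i d g j) :
    (∀ e, (∃ x, Hom.onE g x = e) ∨ ∃ z, Hom.onE j z = e) ∧
      ∀ x z, Hom.onV g x = Hom.onV j z → x ∈ Set.range (Hom.onV i) := by
  obtain ⟨Q, a, b, hQ⟩ := exists_isGluing hi hd
  have hG : a ≫ hQ.isPushout.desc g j h.w = g := hQ.isPushout.inl_desc _ _ _
  have hG' : b ≫ hQ.isPushout.desc g j h.w = j := hQ.isPushout.inr_desc _ _ _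
  have hφ : g ≫ h.desc a b hQ.isPushout.w = a := h.inl_desc _ _ _
  have hφ' : j ≫ h.desc a b hQ.isPushout.w = b := h.inr_desc _ _ _
  generalize hQ.isPushout.desc g j h.w = ψ at hG hG'
  generalize h.desc a b hQ.isPushout.w = φ at hφ hφ'
  have hid : φ ≫ ψ = 𝟙 G := by
    apply h.hom_ext
    · rw [← Category.assoc, hφ, hG, Category.comp_id]
    · rw [← Category.assoc, hφ', hG', Category.comp_id]
  constructor
  · intro e
    have he : Hom.onE ψ (Hom.onE φ e) = e := onE_congr hid e
    rcases hQ.2.cover (Hom.onE φ e) with ⟨x, hx⟩ | ⟨z, hz⟩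
    · exact Or.inl ⟨x, by rw [← onE_congr hG x, comp_onE, hx, he]⟩
    · exact Or.inr ⟨z, by rw [← onE_congr hG' z, comp_onE, hz, he]⟩
  · intro x z hxz
    have hab : Hom.onV a x = Hom.onV b z := by
      rw [← onV_congr hφ x, ← onV_congr hφ' z, comp_onV, comp_onV, hxz]
    obtain ⟨k, hk, -⟩ := hQ.1.meet x z hab
    exact ⟨k, hk⟩

end Pushout

/-! ### The dangling condition and pushout complements -/

section Dangling

variable {K L G : LGraph.{u, v} Λ}

/-- The edge `e` witnesses a failure of the dangling condition: it is not matched, but one of its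
ends is the image of a node to be deleted. -/
def Dangles (l : K ⟶ L) (m : L ⟶ G) (e : G.E) : Prop :=
  e ∉ Set.range (Hom.onE m) ∧ ∃ x, x ∉ Set.range (Hom.onV l) ∧
    (Hom.onV m x = G.src e ∨ Hom.onV m x = G.tgt e)

theorem not_dangles_of_isPushout {D : LGraph.{u, v} Λ} {l : K ⟶ L} {d : K ⟶ D} {m : L ⟶ G}
    {j : D ⟶ G} (hl : Inj l) (hm : Inj m) (h : IsPushout l d m j) (e : G.E) :
    ¬ Dangles l m e := by
  rintro ⟨he, x, hx, hxe⟩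
  have hd : Inj d := Inj.of_comp (g := j) (h.w ▸ hl.comp hm)
  obtain ⟨hc, hmeet⟩ := cover_and_meet_of_isPushout hl hd h
  rcases hc e with ⟨y, hy⟩ | ⟨z, rfl⟩
  · exact he ⟨y, hy⟩
  · rcases hxe with hxe | hxe
    · exact hx (hmeet x (D.src z) (by rw [hxe, Hom.src_comm j]))
    · exact hx (hmeet x (D.tgt z) (by rw [hxe, Hom.tgt_comm j]))

theorem gluingSq_compl {K L G : Type u} {l : K → L} {m : L → G} (hm : Function.Injective m)
    (h : ∀ k x, m x = m (l k) → x ∈ Set.range l) :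
    GluingSq (D := {y : G // ∀ x, m x = y → x ∈ Set.range l}) l
      (fun k => ⟨m (l k), h k⟩) m Subtype.val where
  comm _ := rfl
  inj_left := hm
  inj_right := Subtype.val_injective
  cover y := by
    by_cases hy : ∃ x, m x = y
    · exact Or.inl hy
    · exact Or.inr ⟨⟨y, fun x hx => (hy ⟨x, hx⟩).elim⟩, rfl⟩
  meet := by
    rintro x ⟨z, hz⟩ hxz
    obtain ⟨k, rfl⟩ := hz x hxz
    exact ⟨k, rfl, Subtype.ext hxz⟩

/-- The complement is `G` without the images of the items outside `l`. The absence of dangling edges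
is what makes the endpoints of surviving unmatched edges survive; for matched edges this follows
since they come from `K`. -/
theorem exists_pushoutComplement {l : K ⟶ L} {m : L ⟶ G} (hm : Inj m)
    (h : ∀ e, ¬ Dangles l m e) :
    ∃ (D : LGraph.{u, v} Λ) (d : K ⟶ D) (j : D ⟶ G), IsGluing l d m j := by
  have hV : ∀ k x, Hom.onV m x = Hom.onV m (Hom.onV l k) → x ∈ Set.range (Hom.onV l) :=
    fun k x hx => ⟨k, (hm.1 hx).symm⟩
  have hE : ∀ k x, Hom.onE m x = Hom.onE m (Hom.onE l k) → x ∈ Set.range (Hom.onE l) :=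
    fun k x hx => ⟨k, (hm.2 hx).symm⟩
  let D : LGraph.{u, v} Λ :=
    { V := {y : G.V // ∀ x, Hom.onV m x = y → x ∈ Set.range (Hom.onV l)}
      E := {y : G.E // ∀ x, Hom.onE m x = y → x ∈ Set.range (Hom.onE l)}
      finV := by
        have := G.finV
        infer_instance
      finE := by
        have := G.finE
        infer_instance
      src := fun e => ⟨G.src e.1, fun x hx => by
        by_contra hxl
        by_cases he : e.1 ∈ Set.range (Hom.onE m)
        · obtain ⟨y, hy⟩ := he
          obtain ⟨k, rfl⟩ := e.2 y hy
          rw [← hy, ← Hom.src_comm m, ← Hom.src_comm l] at hx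
          exact hxl (hV _ _ hx)
        · exact h e.1 ⟨he, x, hxl, Or.inl hx⟩⟩
      tgt := fun e => ⟨G.tgt e.1, fun x hx => by
        by_contra hxl
        by_cases he : e.1 ∈ Set.range (Hom.onE m)
        · obtain ⟨y, hy⟩ := he
          obtain ⟨k, rfl⟩ := e.2 y hy
          rw [← hy, ← Hom.tgt_comm m, ← Hom.tgt_comm l] at hx
          exact hxl (hV _ _ hx)
        · exact h e.1 ⟨he, x, hxl, Or.inr hx⟩⟩
      labV := fun x => G.labV x.1
      labE := fun e => G.labE e.1 }
  let j : D ⟶ G := Hom.mk (G := D) Subtype.val Subtype.val (fun _ => rfl) (fun _ => rfl)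
    (fun _ => rfl) (fun _ => rfl)
  let d : K ⟶ D := Hom.mk (H := D) (fun k => ⟨Hom.onV m (Hom.onV l k), hV k⟩)
    (fun k => ⟨Hom.onE m (Hom.onE l k), hE k⟩)
    (fun k => Subtype.ext (Hom.src_comm (l ≫ m) k)) (fun k => Subtype.ext (Hom.tgt_comm (l ≫ m) k))
    (Hom.labV_comm (l ≫ m)) (Hom.labE_comm (l ≫ m))
  exact ⟨D, d, j, gluingSq_compl hm.1 hV, gluingSq_compl hm.2 hE⟩

/-- The graph with one edge between two distinct nodes, with prescribed labels. -/
def edgeGraph (a b c : Λ) : LGraph.{u, v} Λ where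
  V := ULift Bool
  E := PUnit
  finV := inferInstance
  finE := inferInstance
  src _ := ⟨false⟩
  tgt _ := ⟨true⟩
  labV x := if x.down then b else a
  labE _ := c

/-- The morphism from the one-edge graph selecting an edge. -/
def edgeHom (e : G.E) :
    edgeGraph (G.labV (G.src e)) (G.labV (G.tgt e)) (G.labE e) ⟶ G :=
  Hom.mk (G := edgeGraph _ _ _) (fun x => if x.down then G.tgt e else G.src e) (fun _ => e)
    (fun _ => rfl) (fun _ => rfl) (by rintro ⟨_ | _⟩ <;> rfl) (fun _ => rfl)

theorem Dangles.comp_iff {Q : LGraph.{u, v} Λ} {l : K ⟶ L} {m : L ⟶ Q} {q : Q ⟶ G} (hq : Inj q)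
    (e : Q.E) : Dangles l (m ≫ q) (Hom.onE q e) ↔ Dangles l m e := by
  simp only [Dangles, Set.mem_range, comp_onE, comp_onV, ← Hom.src_comm q, ← Hom.tgt_comm q,
    hq.1.eq_iff, hq.2.eq_iff]

end Dangling

end LGraph

open LGraph

/-! ### Constructions on conditions -/

namespace GCond

variable {Λ : Type v} {P : LGraph.{u, v} Λ}

theorem sat_ex {C G : LGraph.{u, v} Λ} (a : P ⟶ C) (ha : Inj a) (c : GCond C) (g : P ⟶ G) :
    (GCond.ex a ha c).Sat g ↔ ∃ q : C ⟶ G, Inj q ∧ a ≫ q = g ∧ c.Sat q := Iff.rfl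

theorem sat_tt {G : LGraph.{u, v} Λ} (g : P ⟶ G) : (GCond.tt : GCond P).Sat g := by
  simp only [Sat]

theorem sat_neg {G : LGraph.{u, v} Λ} (c : GCond P) (g : P ⟶ G) :
    c.neg.Sat g ↔ ¬ c.Sat g := Iff.rfl

theorem exists_finite_disj {ι : Type*} [Finite ι] (c : ι → GCond P) :
    ∃ c' : GCond P, ∀ (G : LGraph.{u, v} Λ) (g : P ⟶ G), c'.Sat g ↔ ∃ i, (c i).Sat g := by
  classical
  have key : ∀ s : Finset ι, ∃ c' : GCond P, ∀ (G : LGraph.{u, v} Λ) (g : P ⟶ G),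
      c'.Sat g ↔ ∃ i ∈ s, (c i).Sat g := by
    intro s
    induction s using Finset.induction_on with
    | empty => exact ⟨.neg .tt, fun G g => by simp [Sat]⟩
    | insert a s _ ih =>
      obtain ⟨c', hc'⟩ := ih
      refine ⟨.neg (.and (.neg (c a)) (.neg c')), fun G g => ?_⟩
      simp only [Sat, hc', Finset.exists_mem_insert]
      rw [not_and_or, not_not, not_not]
  have := Fintype.ofFinite ι
  simpa using key Finset.univ

/-- Shifting a condition along an injective morphism. -/
theorem exists_shift (c : GCond P) : ∀ {P' : LGraph.{u, v} Λ} (b : P ⟶ P'), Inj b →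
    ∃ c' : GCond P', ∀ (G : LGraph.{u, v} Λ) (q : P' ⟶ G), Inj q →
      (c'.Sat q ↔ c.Sat (b ≫ q)) := by
  induction c with
  | tt => exact fun _ _ => ⟨.tt, fun _ _ _ => Iff.rfl⟩
  | neg c ih =>
    intro P' b hb
    obtain ⟨c', hc'⟩ := ih b hb
    exact ⟨.neg c', fun G q hq => not_congr (hc' G q hq)⟩
  | and c₁ c₂ ih₁ ih₂ =>
    intro P' b hb
    obtain ⟨c₁', h₁⟩ := ih₁ b hb
    obtain ⟨c₂', h₂⟩ := ih₂ b hb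
    exact ⟨.and c₁' c₂', fun G q hq => and_congr (h₁ G q hq) (h₂ G q hq)⟩
  | @ex P C a ha c ih =>
    intro P' b hb
    -- The ways to overlap `P'` and `C` that agree on `P`, both embedded injectively.
    let ι := {k : Congr (sum P' C) // Inj (sumInl P' C ≫ proj k) ∧ Inj (sumInr P' C ≫ proj k) ∧
      b ≫ sumInl P' C ≫ proj k = a ≫ sumInr P' C ≫ proj k}
    choose s hs using fun k : ι => ih (sumInr P' C ≫ proj k.1) k.2.2.1
    obtain ⟨c', hc'⟩ := exists_finite_disj
      fun k : ι => GCond.ex (sumInl P' C ≫ proj k.1) k.2.1 (s k)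
    refine ⟨c', fun G q hq => (hc' G q).trans ⟨?_, ?_⟩⟩
    · rintro ⟨k, t, ht, rfl, hst⟩
      refine ⟨(sumInr P' C ≫ proj k.1) ≫ t, k.2.2.1.comp ht, ?_, (hs k G t ht).1 hst⟩
      rw [← Category.assoc, ← Category.assoc b, ← k.2.2.2]
    · rintro ⟨m, hm, hamq, hsat⟩
      have hl : (sumInl P' C ≫ proj (ker (sumDesc q m))) ≫ kerLift (sumDesc q m) = q := rfl
      have hr : (sumInr P' C ≫ proj (ker (sumDesc q m))) ≫ kerLift (sumDesc q m) = m := rfl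
      have hinj := kerLift_inj (sumDesc q m)
      -- The overlap realized in `G` is the joint image of `q` and `m`.
      refine ⟨⟨ker (sumDesc q m), Inj.of_comp (hl.symm ▸ hq), Inj.of_comp (hr.symm ▸ hm), ?_⟩,
        (sat_ex _ _ _ _).2 ⟨kerLift (sumDesc q m), hinj, hl, ?_⟩⟩
      · refine hom_ext (fun x => hinj.1 ?_) fun x => hinj.2 ?_
        · exact onV_congr hamq.symm x
        · exact onE_congr hamq.symm x
      · exact (hs _ G _ hinj).2 hsat

/-- A dangling edge is already visible in the joint image of `L` and that edge. Quotients of `L`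
plus one free edge cover all cases, including loops; finiteness of `Λ` bounds the choices of labels.
-/
theorem exists_dangling [Finite Λ] {K L : LGraph.{u, v} Λ} (l : K ⟶ L) :
    ∃ c : GCond L, ∀ (G : LGraph.{u, v} Λ) (m : L ⟶ G), Inj m →
      (c.Sat m ↔ ∃ e, Dangles l m e) := by
  let ι := Σ w : Λ × Λ × Λ, {k : Congr (sum L (edgeGraph w.1 w.2.1 w.2.2)) //
    Inj (sumInl L (edgeGraph w.1 w.2.1 w.2.2) ≫ proj k) ∧
      ∃ e, Dangles l (sumInl L (edgeGraph w.1 w.2.1 w.2.2) ≫ proj k) e}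
  obtain ⟨c, hc⟩ := exists_finite_disj
    fun k : ι => GCond.ex (sumInl L (edgeGraph k.1.1 k.1.2.1 k.1.2.2) ≫ proj k.2.1) k.2.2.1 .tt
  refine ⟨c, fun G m hm => (hc G m).trans ⟨?_, ?_⟩⟩
  · rintro ⟨⟨w, k, hk, e, he⟩, t, ht, rfl, -⟩
    exact ⟨Hom.onE t e, (Dangles.comp_iff ht e).2 he⟩
  · rintro ⟨e, he⟩
    have hinj := kerLift_inj (sumDesc m (edgeHom e))
    have hl : (sumInl L _ ≫ proj (ker (sumDesc m (edgeHom e)))) ≫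
      kerLift (sumDesc m (edgeHom e)) = m := rfl
    refine ⟨⟨(G.labV (G.src e), G.labV (G.tgt e), G.labE e), ker (sumDesc m (edgeHom e)),
      Inj.of_comp (hl.symm ▸ hm), Hom.onE (sumInr L _ ≫ proj (ker (sumDesc m (edgeHom e))))
        PUnit.unit, ?_⟩, (sat_ex _ _ _ _).2 ⟨kerLift (sumDesc m (edgeHom e)), hinj, hl, sat_tt _⟩⟩
    rw [← Dangles.comp_iff hinj]
    exact he

end GCond

/-! ### Applicability of rules and systems -/

theorem GRule.exists_stepAt_iff {Λ : Type v} (ρ : GRule.{u, v} Λ) {G : LGraph.{u, v} Λ}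
    (m : ρ.plain.L ⟶ G) :
    (∃ H, ρ.StepAt m H) ↔ Inj m ∧ ρ.ac.Sat m ∧ ∀ e, ¬ Dangles ρ.plain.l m e := by
  constructor
  · rintro ⟨H, hm, hac, D, d, h, l', r', h₁, h₂⟩
    exact ⟨hm, hac, not_dangles_of_isPushout ρ.plain.l_inj hm h₁⟩
  · rintro ⟨hm, hac, hd⟩
    obtain ⟨D, d, j, hD⟩ := exists_pushoutComplement hm hd
    have hdinj : Inj d := Inj.of_comp (g := j) (hD.isPushout.w ▸ ρ.plain.l_inj.comp hm)
    -- Once the complement exists, the right-hand pushout is unobstructed.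
    obtain ⟨H, h, r', hH⟩ := exists_isGluing ρ.plain.r_inj hdinj
    exact ⟨H, hm, hac, D, d, h, j, r', hD.isPushout, hH.isPushout⟩

theorem GRule.exists_applicable_cond {Λ : Type v} [Finite Λ] (ρ : GRule.{u, v} Λ)
    (P : LGraph.{u, v} Λ) :
    ∃ c : GCond P, ∀ (G : LGraph.{u, v} Λ) (g : P ⟶ G), Inj g → (c.Sat g ↔ ρ.Applicable G) := by
  obtain ⟨δ, hδ⟩ := GCond.exists_dangling ρ.plain.l
  obtain ⟨c, hc⟩ := GCond.exists_shift
    (.ex (fromEmpty ρ.plain.L) (fromEmpty_inj _) (.and ρ.ac (.neg δ))) (fromEmpty P)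
    (fromEmpty_inj P)
  refine ⟨c, fun G g hg => (hc G g hg).trans ?_⟩
  have happ : ρ.Applicable G ↔ ∃ m, ∃ H, ρ.StepAt (G := G) m H := exists_comm
  simp only [happ, ρ.exists_stepAt_iff, GCond.Sat]
  refine exists_congr fun m => and_congr_right fun hm => ?_
  rw [hδ G m hm, not_exists]
  exact and_iff_right (hom_empty_ext _ _)

theorem GTS.exists_app {Λ : Type v} [Finite Λ] (S : GTS.{u, v} Λ) (P : LGraph.{u, v} Λ) :
    ∃ c : GCond P, ∀ (G : LGraph.{u, v} Λ) (g : P ⟶ G), Inj g →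
      (c.Sat g ↔ ∃ ρ ∈ S.rules, ρ.Applicable G) := by
  have := S.fin.to_subtype
  choose c hc using fun ρ : S.rules => ρ.1.exists_applicable_cond P
  obtain ⟨c', hc'⟩ := GCond.exists_finite_disj c
  refine ⟨c', fun G g hg => (hc' G g).trans ?_⟩
  simp only [hc _ G g hg, Subtype.exists, exists_prop]

theorem GTS.exists_step_iff {Λ : Type v} (S : GTS.{u, v} Λ) (G : LGraph.{u, v} Λ) :
    (∃ H, S.Step G H) ↔ ∃ ρ ∈ S.rules, ρ.Applicable G :=
  ⟨fun ⟨H, ρ, hρ, h⟩ => ⟨ρ, hρ, H, h⟩, fun ⟨ρ, hρ, H, h⟩ => ⟨H, ρ, hρ, h⟩⟩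

theorem GRule.skip_applicable_iff {Λ : Type v} (c : GCond (PlainRule.skip.{u, v} Λ).L)
    (G : LGraph.{u, v} Λ) :
    GRule.Applicable ⟨PlainRule.skip Λ, c⟩ G ↔ c.Sat (fromEmpty G) := by
  have happ : GRule.Applicable ⟨PlainRule.skip Λ, c⟩ G ↔
    ∃ m, ∃ H, GRule.StepAt (G := G) ⟨PlainRule.skip Λ, c⟩ m H := exists_comm
  simp only [happ, GRule.exists_stepAt_iff]
  constructor
  · rintro ⟨m, -, hm, -⟩
    rwa [hom_empty_ext (fromEmpty G) m]
  -- A dangling edge would require a deleted node in the empty graph.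
  · exact fun h => ⟨fromEmpty G, fromEmpty_inj G, h, fun e he => he.2.choose.elim⟩

theorem mainTheorem9 {Λ : Type v} [Finite Λ] :
    ∃ app : (S : GTS.{u, v} Λ) → (p : PlainRule.{u, v} Λ) → GCond p.L,
      ∀ S : GTS.{u, v} Λ,
        (∀ (p : PlainRule.{u, v} Λ) (G H' : LGraph.{u, v} Λ) (g : p.L ⟶ G),
          p.toRule.StepAt g H' → ((app S p).Sat g ↔ ∃ H, S.Step G H)) ∧
        (∀ (p : PlainRule.{u, v} Λ) (G : LGraph.{u, v} Λ),
          GRule.Applicable ⟨p, (app S p).neg⟩ G → ∀ ρ ∈ S.rules, ¬ ρ.Applicable G) ∧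
        (∀ G : LGraph.{u, v} Λ,
          GRule.Applicable ⟨PlainRule.skip Λ, (app S (PlainRule.skip Λ)).neg⟩ G ↔
            ∀ ρ ∈ S.rules, ¬ ρ.Applicable G) ∧
        (∀ G : LGraph.{u, v} Λ, ∃ H, (S.addSkip (app S (PlainRule.skip Λ))).Step G H) := by
  choose app happ using fun (S : GTS.{u, v} Λ) (p : PlainRule.{u, v} Λ) => S.exists_app p.L
  have hskip : ∀ (S : GTS.{u, v} Λ) (G : LGraph.{u, v} Λ),
      GRule.Applicable ⟨PlainRule.skip Λ, (app S (PlainRule.skip Λ)).neg⟩ G ↔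
        ∀ ρ ∈ S.rules, ¬ ρ.Applicable G := by
    intro S G
    refine (GRule.skip_applicable_iff _ G).trans ((GCond.sat_neg _ _).trans
      ((not_congr (happ S (PlainRule.skip Λ) G _ (fromEmpty_inj G))).trans ?_))
    simp only [not_exists, not_and]
  refine ⟨app, fun S => ⟨?_, ?_, hskip S, ?_⟩⟩
  · intro p G H' g hg
    rw [happ S p G g hg.1, S.exists_step_iff]
  · rintro p G ⟨H, g, hg, hsat, -⟩ ρ hρ h
    exact hsat ((happ S p G g hg).2 ⟨ρ, hρ, h⟩)
  · intro G
    rw [GTS.exists_step_iff]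
    by_cases h : ∃ ρ ∈ S.rules, ρ.Applicable G
    · obtain ⟨ρ, hρ, hG⟩ := h
      exact ⟨ρ, Or.inl hρ, hG⟩
    · exact ⟨_, Or.inr rfl, (hskip S G).2 fun ρ hρ hG => h ⟨ρ, hρ, hG⟩⟩
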